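/- Let $\mathcal D=(V,E)$ be a directed acyclic graph with $V=\{1,\dots,d\}$, let $C=(c_{ij})\in\mathbb R_+^{d\times d}$ with $c_{ij}=0$ unless $j\to i$ is an edge, let $s_{ii}>0$ for $i\in V$, $S=\mathrm{diag}(s_{11},\dots,s_{dd})$, and let the random vector $X$ be given by the linear structural equations \[X_i=\sum_{j\in\mathrm{pa}(i)}c_{ij}X_j+s_{ii}Z_i,\qquad i\in V,\] where $Z$ is a random vector in $\mathbb R_+^d$. Let $\|\cdot\|$ be the Euclidean norm, $\Theta_+^{d-1}=\{\omega\in\mathbb R_+^d:\|\omega\|=1\}$, and for $\alpha>0$ let $\nu_\alpha$ be the measure on $(0,\infty]$ given by $d\nu_\alpha(x)=\alpha x^{-\alpha-1}\,dx$. A finite measure $H$ on $\Theta_+^{d-1}$ is called the angular measure of a random vector $Y\in\mathbb R_+^d$ with index $\alpha$ and normalising sequence $b_n\to\infty$ if, as $n\to\infty$, \[n\,\mathbb P\big((\|Y\|/b_n,\;Y/\|Y\|)\in\cdot\,\big)\to\nu_\alpha\times H\quad\text{vaguely on }(0,\infty]\times\Theta_+^{d-1},\] and $Y\in\mathrm{RV}_+^d(\alpha)$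 means that this holds for some sequence $b_n\to\infty$ and some $H\neq0$. Assume that $Z\in\mathrm{RV}_+^d(2)$ has independent components that are standardised, that is, $n\,\mathbb P(n^{-1/2}Z_i>z)\to z^{-2}$ as $n\to\infty$ for all $z>0$ and $i\in V$. Then $X=AZ$ with $A=(a_{ij})=(I-C)^{-1}S\in\mathbb R_+^{d\times d}$, $X\in\mathrm{RV}_+^d(2)$, and $X$ has exactly one angular measure $H_X$ with index $2$ and normalising sequence $b_n=n^{1/2}$. Write $a_k$ for the $k$-th column of $A$, and put \[\sigma_{ij}^2=\int_{\Theta_+^{d-1}}\omega_i\omega_j\,dH_X(\omega),\qquad \sigma_i=(\sigma_{ii}^2)^{1/2}.\] Then: (i) the support of $H_X$ is the set of normalised columns $\{a_k/\|a_k\|:k\in V\}$; (ii) $\sigma_{ij}^2=(AA^\top)_{ij}=\sum_{k=1}^d a_{ik}a_{jk}$ for all $i,j\in V$; (iii) the squared scaling of the margin $X_i$ is $\sigma_i^2=\sum_{k=1}^d a_{ik}^2$ for all $i\in V$. -/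

import Mathlib

open MeasureTheory ProbabilityTheory Filter Topology
open scoped ENNReal

noncomputable section

/-- A non-negative linear structural equation model on `d` nodes: a directed acyclic graph
(`graph.Adj j i` is the edge `j → i`), edge weights `C i j ≥ 0`, with `C i j` the weight of the
edge `j → i` and zero when there is no such edge, and innovation weights `s i > 0`. -/
structure LSEMPlus (d : ℕ) where
  graph : Digraph (Fin d)
  acyclic : ∀ i, ¬ Relation.TransGen graph.Adj i i
  C : Matrix (Fin d) (Fin d) ℝ
  C_nonneg : ∀ i j, 0 ≤ C i j
  C_eq_zero : ∀ i j, ¬ graph.Adj j i → C i j = 0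
  s : Fin d → ℝ
  s_pos : ∀ i, 0 < s i

namespace LSEMPlus

variable {d : ℕ}

open Classical in
/-- The parents of the node `i`. -/
def pa (M : LSEMPlus d) (i : Fin d) : Finset (Fin d) :=
  Finset.univ.filter fun j => M.graph.Adj j i

/-- The innovation coefficient matrix `A = (I - C)⁻¹ S`. -/
def coeffMatrix (M : LSEMPlus d) : Matrix (Fin d) (Fin d) ℝ :=
  (1 - M.C)⁻¹ * Matrix.diagonal M.s

/-- The random vector `X` follows the model `M` with innovations `Z`:
`X i = ∑ j ∈ pa i, C i j * X j + s i * Z i` for every node `i`. -/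
def IsSolution (M : LSEMPlus d) {Ω : Type*} (Z X : Ω → EuclideanSpace ℝ (Fin d)) : Prop :=
  ∀ ω i, X ω i = ∑ j ∈ M.pa i, M.C i j * X ω j + M.s i * Z ω i

end LSEMPlus

/-- The part of the Euclidean unit sphere of `ℝᵈ` in the non-negative orthant. -/
def posSphere (d : ℕ) : Set (EuclideanSpace ℝ (Fin d)) :=
  {w | (∀ i, 0 ≤ w i) ∧ ‖w‖ = 1}

/-- The half-line `(0, ∞]`; its compact subsets are bounded away from `0`. -/
abbrev PosRadii : Type := Set.Ioi (0 : ℝ≥0∞)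

/-- Vague convergence: convergence of the integrals of all compactly supported continuous
functions. -/
def VagueTendsto {E : Type*} [TopologicalSpace E] [MeasurableSpace E]
    (μ : ℕ → Measure E) (ν : Measure E) : Prop :=
  ∀ f : CompactlySupportedContinuousMap E ℝ,
    Tendsto (fun n => ∫ x, f x ∂(μ n)) atTop (𝓝 (∫ x, f x ∂ν))

/-- The measure `ν_α` on `(0, ∞]` with density `α x ^ (-α - 1)` on `(0, ∞)` and no mass
at `∞`. -/
def powerMeasure (α : ℝ) : Measure PosRadii :=
  Measure.comap Subtype.val
    (Measure.map ENNReal.ofReal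
      ((volume.restrict (Set.Ioi (0 : ℝ))).withDensity
        fun x => ENNReal.ofReal (α * x ^ (-α - 1))))

/-- The measure `P ((R / b, X / R) ∈ ·)`, `R = ‖X‖`, on `(0, ∞] × posSphere d`. The event
`X = 0`, where the angle is undefined, is sent to `(0, 0)`, outside this space, and so does
not contribute. -/
def polarLaw {d : ℕ} {Ω : Type*} [MeasurableSpace Ω] (P : Measure Ω)
    (X : Ω → EuclideanSpace ℝ (Fin d)) (b : ℝ) : Measure (PosRadii × posSphere d) :=
  Measure.comap (Prod.map Subtype.val Subtype.val)
    (P.map fun ω => (ENNReal.ofReal (‖X ω‖ / b), ‖X ω‖⁻¹ • X ω))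

/-- `H` is the angular measure (for the Euclidean norm) of the random vector `X`, with index
`α` and normalising sequence `b`: `H` is finite, `b n → ∞`, and `n P ((R / b n, X / R) ∈ ·)`
converges vaguely to `ν_α × H` on `(0, ∞] × posSphere d`. -/
structure IsAngularMeasure {d : ℕ} {Ω : Type*} [MeasurableSpace Ω] (P : Measure Ω)
    (X : Ω → EuclideanSpace ℝ (Fin d)) (α : ℝ) (b : ℕ → ℝ) (H : Measure (posSphere d)) :
    Prop where
  finite : IsFiniteMeasure H
  tendsto_atTop : Tendsto b atTop atTop
  vague : VagueTendsto (fun n : ℕ => (n : ℝ≥0∞) • polarLaw P X (b n))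
    ((powerMeasure α).prod H)

/-- `X ∈ RV₊ᵈ(α)`: the random vector `X` has non-negative components and is multivariate
regularly varying with index `α > 0`. The limit is required to be non-zero, as otherwise every
random vector would qualify, with a rapidly growing `b`. -/
def IsRegularlyVarying {d : ℕ} {Ω : Type*} [MeasurableSpace Ω] (P : Measure Ω)
    (X : Ω → EuclideanSpace ℝ (Fin d)) (α : ℝ) : Prop :=
  0 < α ∧ (∀ ω i, 0 ≤ X ω i) ∧
    ∃ (b : ℕ → ℝ) (H : Measure (posSphere d)), H ≠ 0 ∧ IsAngularMeasure P X α b H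

/-- The random variable `Y` is standardised with index `α`:
`n P (n ^ (-1 / α) Y > z) → z ^ (-α)` for all `z > 0`. -/
def IsStandardised {Ω : Type*} [MeasurableSpace Ω] (P : Measure Ω) (Y : Ω → ℝ) (α : ℝ) :
    Prop :=
  ∀ z : ℝ, 0 < z →
    Tendsto (fun n : ℕ => (n : ℝ) * P.real {ω | z < (n : ℝ) ^ (-1 / α) * Y ω}) atTop
      (𝓝 (z ^ (-α)))

/-- The extremal dependence measure `σ²_{ij} = ∫ ω_i ω_j dH(ω)`. -/
def extremalDependence {d : ℕ} (H : Measure (posSphere d)) (i j : Fin d) : ℝ :=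
  ∫ w, w.1 i * w.1 j ∂H

/-- The scaling `σ_i = (σ²_{ii})^{1/2}` of the `i`-th component. -/
def scaling {d : ℕ} (H : Measure (posSphere d)) (i : Fin d) : ℝ :=
  √(extremalDependence H i i)

/-- The `k`-th column of `A`, as a vector of Euclidean space. -/
def columnVec {d : ℕ} (A : Matrix (Fin d) (Fin d) ℝ) (k : Fin d) : EuclideanSpace ℝ (Fin d) :=
  WithLp.toLp 2 fun i => A i k

end

/-! Acyclicity makes $I-C$ invertible and $A$ non-negative with positive diagonal, so no column of
$A$ vanishes. By independence two coordinates of $Z$ exceed levels of order $n^{1/2}$ together with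
probability $O(n^{-2})$. Hence $n\,\mathbb P(n^{-1/2}Z\in\cdot)$ concentrates on the axes, and
standardisation puts $\nu_2$ on each of them. The matrix $A$ sends $te_k$ to $ta_k$, of radius
$t\|a_k\|$, and $\nu_2$ is homogeneous of order $-2$. So $H_X=\sum_k\|a_k\|^2\delta_{a_k/\|a_k\|}$
(`columnMeasure`), and (i)–(iii) are read off from this formula.

For the convergence, a test function $f$ in polar coordinates becomes $G=$ `polarLift f` $\circ A$,
which is bounded, continuous on the orthant and zero near the origin.
`tendsto_mul_integral_sub_sum_single` replaces $G$ by its values on the axes,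
`tendsto_integral_of_tendsto_tail` gives the limit on each axis, and `integral_prod_columnMeasure`
identifies the sum of these limits. Uniqueness (`IsAngularMeasure.unique`) comes from product test
functions. -/

namespace LSEMPlus

/-! ### The coefficient matrix of an acyclic model -/

variable {d : ℕ}

/-- The transitive closure of an acyclic relation is a strict order, and strict orders on finite
sets are well-founded. This permits induction from parents to children. -/
lemma wellFounded_adj (M : LSEMPlus d) : WellFounded M.graph.Adj := by
  have : IsTrans (Fin d) (Relation.TransGen M.graph.Adj) := ⟨fun _ _ _ => Relation.TransGen.trans⟩
  have : Std.Irrefl (Relation.TransGen M.graph.Adj) := ⟨M.acyclic⟩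
  exact Subrelation.wf (fun h => Relation.TransGen.single h)
    (Finite.wellFounded_of_trans_of_irrefl (Relation.TransGen M.graph.Adj))

/-- A solution of the structural equations with non-negative innovations is non-negative. -/
lemma nonneg_of_eq_mulVec_add (M : LSEMPlus d) {v w : Fin d → ℝ} (hw : ∀ i, 0 ≤ w i)
    (h : ∀ i, v i = ∑ j, M.C i j * v j + w i) (i : Fin d) : 0 ≤ v i := by
  induction i using M.wellFounded_adj.induction with
  | _ i ih =>
    rw [h i]
    refine add_nonneg (Finset.sum_nonneg fun j _ => ?_) (hw i)
    by_cases hj : M.graph.Adj j i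
    · exact mul_nonneg (M.C_nonneg i j) (ih j hj)
    · simp [M.C_eq_zero i j hj]

lemma one_sub_mulVec_apply (M : LSEMPlus d) (v : Fin d → ℝ) (i : Fin d) :
    (1 - M.C).mulVec v i = v i - ∑ j, M.C i j * v j := by
  rw [Matrix.sub_mulVec, Matrix.one_mulVec]
  rfl

/-- A kernel vector solves the equations with zero innovations, hence is non-negative. So is its
negative, and both vanish. -/
lemma isUnit_det_one_sub (M : LSEMPlus d) : IsUnit (1 - M.C).det := by
  rw [← Matrix.isUnit_iff_isUnit_det, ← Matrix.mulVec_injective_iff_isUnit]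
  have key : ∀ v : Fin d → ℝ, (1 - M.C).mulVec v = 0 → ∀ i, 0 ≤ v i := fun v hv =>
    M.nonneg_of_eq_mulVec_add (w := 0) (fun _ => le_rfl) fun i => by
      have := congrFun hv i
      rw [one_sub_mulVec_apply] at this
      simp only [Pi.zero_apply] at this ⊢
      linarith
  intro v w hvw
  have h1 : (1 - M.C).mulVec (v - w) = 0 := by rw [Matrix.mulVec_sub, sub_eq_zero]; exact hvw
  have h2 : (1 - M.C).mulVec (w - v) = 0 := by rw [Matrix.mulVec_sub, sub_eq_zero]; exact hvw.symm
  ext i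
  have h3 := key _ h1 i
  have h4 := key _ h2 i
  simp only [Pi.sub_apply] at h3 h4
  linarith

/-- Each column of $A$ solves the structural equations with a column of $S$ as innovation, so the
positivity lemma applies to it. -/
lemma coeffMatrix_apply (M : LSEMPlus d) (i k : Fin d) :
    M.coeffMatrix i k = ∑ j, M.C i j * M.coeffMatrix j k + Matrix.diagonal M.s i k := by
  have h : (1 - M.C) * M.coeffMatrix = Matrix.diagonal M.s :=
    Matrix.mul_nonsing_inv_cancel_left _ _ M.isUnit_det_one_sub
  have := congrFun (congrFun h i) k
  rw [Matrix.sub_mul, Matrix.one_mul, Matrix.sub_apply, Matrix.mul_apply] at this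
  linarith

lemma coeffMatrix_nonneg (M : LSEMPlus d) (i k : Fin d) : 0 ≤ M.coeffMatrix i k :=
  M.nonneg_of_eq_mulVec_add (v := fun i => M.coeffMatrix i k)
    (w := fun i => Matrix.diagonal M.s i k)
    (fun i => by
      rw [Matrix.diagonal_apply]
      split_ifs
      exacts [(M.s_pos i).le, le_rfl])
    (fun i => M.coeffMatrix_apply i k) i

lemma coeffMatrix_diag_pos (M : LSEMPlus d) (k : Fin d) : 0 < M.coeffMatrix k k := by
  rw [M.coeffMatrix_apply k k, Matrix.diagonal_apply_eq]
  exact add_pos_of_nonneg_of_pos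
    (Finset.sum_nonneg fun j _ => mul_nonneg (M.C_nonneg k j) (M.coeffMatrix_nonneg j k))
    (M.s_pos k)

lemma columnVec_coeffMatrix_ne_zero (M : LSEMPlus d) (k : Fin d) :
    columnVec M.coeffMatrix k ≠ 0 := fun h =>
  (M.coeffMatrix_diag_pos k).ne' (congrArg (fun v : EuclideanSpace ℝ (Fin d) => v k) h)

lemma IsSolution.eq_coeffMatrix_mulVec {M : LSEMPlus d} {Ω : Type*}
    {Z X : Ω → EuclideanSpace ℝ (Fin d)} (hX : M.IsSolution Z X) (ω : Ω) :
    X ω = WithLp.toLp 2 (M.coeffMatrix.mulVec (Z ω).ofLp) := by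
  have h : (1 - M.C).mulVec (X ω).ofLp = (Matrix.diagonal M.s).mulVec (Z ω).ofLp := by
    ext i
    rw [M.one_sub_mulVec_apply, Matrix.mulVec_diagonal, hX ω i]
    have : ∑ j ∈ M.pa i, M.C i j * X ω j = ∑ j, M.C i j * X ω j := by
      refine Finset.sum_subset (Finset.subset_univ _) fun j _ hj => ?_
      rw [M.C_eq_zero i j (fun hji => hj (by simpa [pa] using hji)), zero_mul]
    rw [this]
    ring
  have h2 : (X ω).ofLp = M.coeffMatrix.mulVec (Z ω).ofLp := by
    rw [coeffMatrix, ← Matrix.mulVec_mulVec, ← h, Matrix.mulVec_mulVec,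
      Matrix.nonsing_inv_mul _ M.isUnit_det_one_sub, Matrix.one_mulVec]
  rw [← h2]

end LSEMPlus

/-! ### From tails to integrals on the line -/

/-- If the tails of a sequence of measures on the line converge to those of `ν` at all levels
`z ≥ δ`, then so do the integrals of bounded continuous functions vanishing on `(-∞, δ]`. -/
lemma tendsto_integral_of_tendsto_tail {μ : ℕ → Measure ℝ} {ν : Measure ℝ}
    [∀ n, IsFiniteMeasure (μ n)] {δ : ℝ} (hν : ν (Set.Ioi δ) ≠ ∞) (hν0 : ν (Set.Ioi δ) ≠ 0)
    (h : ∀ z, δ ≤ z →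
      Tendsto (fun n => (μ n).real (Set.Ioi z)) atTop (𝓝 (ν.real (Set.Ioi z))))
    (g : BoundedContinuousFunction ℝ ℝ) (hg : ∀ t ≤ δ, g t = 0) :
    Tendsto (fun n => ∫ t, g t ∂(μ n)) atTop (𝓝 (∫ t, g t ∂ν)) := by
  -- Discarding $(-\infty,\delta]$, where `g` vanishes, leaves finite measures even if `ν` is
  -- infinite near the origin.
  let m : ℕ → FiniteMeasure ℝ := fun n => ⟨(μ n).restrict (Set.Ioi δ), inferInstance⟩
  have : IsFiniteMeasure (ν.restrict (Set.Ioi δ)) := ⟨by simpa using hν.lt_top⟩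
  let m' : FiniteMeasure ℝ := ⟨ν.restrict (Set.Ioi δ), this⟩
  have hfin : ∀ z, δ ≤ z → ν (Set.Ioi z) ≠ ∞ := fun z hz =>
    ne_top_of_le_ne_top hν (measure_mono (Set.Ioi_subset_Ioi hz))
  -- The maxima keep both levels at or above `δ`, where tails converge, and also cover the case `b <
  -- a`.
  have hIoc : ∀ a b, Set.Ioc a b ∩ Set.Ioi δ =
      Set.Ioi (max a δ) \ Set.Ioi (max b (max a δ)) := by
    intro a b
    ext x
    simp only [Set.mem_inter_iff, Set.mem_Ioc, Set.mem_Ioi, Set.mem_sdiff, max_lt_iff, not_and_or,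
      not_lt]
    grind
  have hset : ∀ a b, Tendsto (fun n => ((m n : Measure ℝ)).real (Set.Ioc a b)) atTop
      (𝓝 ((m' : Measure ℝ).real (Set.Ioc a b))) := by
    intro a b
    have hmeas : ∀ κ : Measure ℝ, κ (Set.Ioi (max a δ)) ≠ ∞ →
        (κ.restrict (Set.Ioi δ)).real (Set.Ioc a b) =
          κ.real (Set.Ioi (max a δ)) - κ.real (Set.Ioi (max b (max a δ))) := by
      intro κ hκ
      rw [measureReal_restrict_apply measurableSet_Ioc, hIoc,
        measureReal_sdiff (Set.Ioi_subset_Ioi (le_max_right _ _)) measurableSet_Ioi hκ]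
    have e1 : ∀ n, (m n : Measure ℝ).real (Set.Ioc a b) = _ :=
      fun n => hmeas (μ n) (measure_ne_top _ _)
    have e2 : (m' : Measure ℝ).real (Set.Ioc a b) = _ := hmeas ν (hfin _ (le_max_right _ _))
    simp_rw [e1, e2]
    exact (h _ (le_max_right _ _)).sub (h _ ((le_max_right _ _).trans (le_max_right _ _)))
  have hmass : Tendsto (fun n => (m n).mass) atTop (𝓝 m'.mass) := by
    have := h δ le_rfl
    rw [← NNReal.tendsto_coe]
    convert this using 1
    · ext n
      change ((m n : Measure ℝ).real Set.univ) = _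
      simp [m, Measure.real]
    · change 𝓝 ((m' : Measure ℝ).real Set.univ) = _
      simp [m', Measure.real]
  have hm' : m' ≠ 0 := by
    intro h0
    apply hν0
    have := congrArg (fun κ : FiniteMeasure ℝ => (κ : Measure ℝ) Set.univ) h0
    simpa [m'] using this
  have hmass0 : m'.mass ≠ 0 := m'.mass_nonzero_iff.mpr hm'
  -- As the masses converge to a non-zero limit, one may normalise. Half-open intervals then form a
  -- convergence-determining π-system.
  have hconv : Tendsto m atTop (𝓝 m') := by
    refine FiniteMeasure.tendsto_of_tendsto_normalize_testAgainstNN_of_tendsto_mass ?_ hmass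
    let S : Set (Set ℝ) := {s | ∃ a b, s = Set.Ioc a b}
    refine IsPiSystem.tendsto_probabilityMeasure_of_tendsto_of_mem (S := S) ?_ ?_ ?_ ?_
    · rintro _ ⟨a, b, rfl⟩ _ ⟨a', b', rfl⟩ _
      exact ⟨_, _, Set.Ioc_inter_Ioc⟩
    · rintro _ ⟨a, b, rfl⟩
      exact measurableSet_Ioc
    · intro u hu x hx
      obtain ⟨ε, hε, hsub⟩ := Metric.isOpen_iff.mp hu x hx
      refine ⟨Set.Ioc (x - ε / 2) (x + ε / 2), ⟨_, _, rfl⟩,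
        Ioc_mem_nhds (by linarith) (by linarith), fun y hy => hsub ?_⟩
      rw [Metric.mem_ball, Real.dist_eq, abs_lt]
      constructor <;> linarith [hy.1, hy.2]
    · rintro _ ⟨a, b, rfl⟩
      have hne : ∀ᶠ n in atTop, m n ≠ 0 := by
        filter_upwards [hmass.eventually_ne hmass0] with n hn
        exact (m n).mass_nonzero_iff.mp hn
      rw [FiniteMeasure.normalize_eq_of_nonzero _ hm']
      have : Tendsto (fun n => (m n).mass⁻¹ * m n (Set.Ioc a b)) atTop
          (𝓝 (m'.mass⁻¹ * m' (Set.Ioc a b))) := by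
        refine (hmass.inv₀ hmass0).mul ?_
        rw [← NNReal.tendsto_coe]
        exact hset a b
      refine this.congr' ?_
      filter_upwards [hne] with n hn
      rw [FiniteMeasure.normalize_eq_of_nonzero _ hn]
  have hint := (FiniteMeasure.tendsto_iff_forall_integral_tendsto.mp hconv) g
  have hres : ∀ κ : Measure ℝ, ∫ t, g t ∂(κ.restrict (Set.Ioi δ)) = ∫ t, g t ∂κ := fun κ =>
    setIntegral_eq_integral_of_forall_compl_eq_zero fun t ht => hg t (by simpa using ht)
  have e1 : ∀ n, ∫ t, g t ∂(m n : Measure ℝ) = ∫ t, g t ∂(μ n) := fun n => hres (μ n)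
  have e2 : ∫ t, g t ∂(m' : Measure ℝ) = ∫ t, g t ∂ν := hres ν
  simpa only [e1, e2] using hint

/-! ### The single big jump principle -/

/-- Single big jump: a continuous function on the orthant that vanishes near the origin is close to
the sum of its values on the projections to the axes, unless some coordinate is very large or two
coordinates are not small. -/
lemma exists_forall_abs_sub_sum_single_le {d : ℕ} {G : (Fin d → ℝ) → ℝ}
    (hG : ContinuousOn G (Set.Ici 0)) {B δ : ℝ} (hB : ∀ z, |G z| ≤ B) (hδ : 0 < δ)
    (h0 : ∀ z, 0 ≤ z → (∀ i, z i ≤ δ) → G z = 0) (M : ℝ) {ε : ℝ} (hε : 0 < ε) :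
    ∃ η > 0, ∀ z, 0 ≤ z → |G z - ∑ k, G (Pi.single k (z k))| ≤
      (d + 1) * B * (∑ k, (if M < z k then 1 else 0) +
        ∑ k, ∑ j, if j ≠ k ∧ η < z k ∧ η < z j then 1 else 0) +
      ε * ∑ k, if δ < z k then 1 else 0 := by
  -- Uniform continuity holds only on a bounded box; the indicators of `M < z k` pay for leaving it.
  have hcomp : IsCompact (Set.Icc (0 : Fin d → ℝ) fun _ => M) := isCompact_Icc
  have hu := hcomp.uniformContinuousOn_of_continuous (hG.mono fun z hz => hz.1)
  obtain ⟨η₀, hη₀, hη⟩ := Metric.uniformContinuousOn_iff.mp hu ε hε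
  have hB0 : 0 ≤ B := (abs_nonneg _).trans (hB 0)
  have hS1 : ∀ z : Fin d → ℝ, 0 ≤ ∑ k, (if M < z k then (1 : ℝ) else 0) := fun z =>
    Finset.sum_nonneg fun k _ => by split_ifs <;> norm_num
  have hS2 : ∀ (η : ℝ) (z : Fin d → ℝ),
      0 ≤ ∑ k, ∑ j, (if j ≠ k ∧ η < z k ∧ η < z j then (1 : ℝ) else 0) := fun η z =>
    Finset.sum_nonneg fun k _ => Finset.sum_nonneg fun j _ => by split_ifs <;> norm_num
  have hS3 : ∀ z : Fin d → ℝ, 0 ≤ ∑ k, (if δ < z k then (1 : ℝ) else 0) := fun z =>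
    Finset.sum_nonneg fun k _ => by split_ifs <;> norm_num
  have hcrude : ∀ z : Fin d → ℝ, |G z - ∑ k, G (Pi.single k (z k))| ≤ (d + 1) * B := by
    intro z
    calc |G z - ∑ k, G (Pi.single k (z k))|
        ≤ |G z| + |∑ k, G (Pi.single k (z k))| := abs_sub _ _
      _ ≤ B + ∑ _k : Fin d, B :=
          add_le_add (hB z) ((Finset.abs_sum_le_sum_abs _ _).trans
            (Finset.sum_le_sum fun k _ => hB _))
      _ = (d + 1) * B := by simp; ring
  have hdB : 0 ≤ ((d : ℝ) + 1) * B := by positivity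
  -- With `η ≤ δ`, coordinates below `η` contribute nothing to the sum over axes. With `η ≤ η₀ / 2`,
  -- a point with one large coordinate is within `η₀` of its projection to that axis.
  refine ⟨min δ (η₀ / 2), lt_min hδ (by positivity), fun z hz => ?_⟩
  set η := min δ (η₀ / 2) with hη_def
  by_cases h1 : ∃ k, M < z k
  · obtain ⟨k, hk⟩ := h1
    have : (1 : ℝ) ≤ ∑ k, (if M < z k then (1 : ℝ) else 0) := by
      refine le_trans ?_ (Finset.single_le_sum
        (f := fun k => if M < z k then (1 : ℝ) else 0)
        (fun k _ => by split_ifs <;> norm_num) (Finset.mem_univ k))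
      simp [hk]
    nlinarith [hcrude z, hS2 η z, mul_nonneg hε.le (hS3 z),
      mul_le_mul_of_nonneg_left (add_le_add this (hS2 η z)) hdB]
  by_cases h2 : ∃ k j, j ≠ k ∧ η < z k ∧ η < z j
  · obtain ⟨k, j, hkj⟩ := h2
    have : (1 : ℝ) ≤ ∑ k, ∑ j, (if j ≠ k ∧ η < z k ∧ η < z j then (1 : ℝ) else 0) := by
      refine le_trans ?_ (Finset.single_le_sum
        (f := fun k => ∑ j, (if j ≠ k ∧ η < z k ∧ η < z j then (1 : ℝ) else 0))
        (fun k _ => Finset.sum_nonneg fun j _ => by split_ifs <;> norm_num) (Finset.mem_univ k))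
      refine le_trans ?_ (Finset.single_le_sum
        (f := fun j => (if j ≠ k ∧ η < z k ∧ η < z j then (1 : ℝ) else 0))
        (fun j _ => by split_ifs <;> norm_num) (Finset.mem_univ j))
      simp only [if_pos hkj, le_refl]
    nlinarith [hcrude z, hS1 z, mul_nonneg hε.le (hS3 z),
      mul_le_mul_of_nonneg_left (add_le_add (hS1 z) this) hdB]
  push Not at h1 h2
  have hηδ : η ≤ δ := min_le_left _ _
  have hz0 : ∀ k, 0 ≤ z k := hz
  have hsingle : ∀ k, (0 : Fin d → ℝ) ≤ Pi.single k (z k) := fun k => Pi.single_nonneg.mpr (hz0 k)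
  have hsmall : ∀ k, z k ≤ δ → G (Pi.single k (z k)) = 0 := by
    intro k hk
    refine h0 _ (hsingle k) fun i => ?_
    rcases eq_or_ne i k with rfl | hik
    · simpa using hk
    · simpa [hik] using hδ.le
  have hfirst : 0 ≤ (d + 1) * B * (∑ k, (if M < z k then (1 : ℝ) else 0) +
        ∑ k, ∑ j, if j ≠ k ∧ η < z k ∧ η < z j then 1 else 0) :=
    mul_nonneg hdB (add_nonneg (hS1 z) (hS2 η z))
  by_cases h3 : ∃ k, δ < z k
  · obtain ⟨k, hk⟩ := h3
    have hoth : ∀ j, j ≠ k → z j ≤ η := fun j hj => h2 k j hj (hηδ.trans_lt hk)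
    have hsum : ∑ j, G (Pi.single j (z j)) = G (Pi.single k (z k)) :=
      Finset.sum_eq_single k (fun j _ hj => hsmall j ((hoth j hj).trans hηδ))
        (fun h => absurd (Finset.mem_univ k) h)
    have hdist : dist z (Pi.single k (z k)) < η₀ := by
      refine lt_of_le_of_lt ((dist_pi_le_iff (r := η₀ / 2) (by positivity)).mpr fun j => ?_)
        (half_lt_self hη₀)
      rcases eq_or_ne j k with rfl | hj
      · simp only [Pi.single_eq_same, dist_self]
        positivity
      · simp only [Pi.single_eq_of_ne hj, Real.dist_eq, sub_zero, abs_of_nonneg (hz0 j)]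
        exact (hoth j hj).trans (min_le_right _ _)
    have hM0 : 0 ≤ M := (hz0 k).trans (h1 k)
    have hlt := hη z ⟨hz, h1⟩ (Pi.single k (z k)) ⟨hsingle k, fun j => by
      rcases eq_or_ne j k with rfl | hj
      · simpa using h1 j
      · simpa [hj] using hM0⟩ hdist
    rw [hsum, ← Real.dist_eq]
    have : (1 : ℝ) ≤ ∑ k, (if δ < z k then (1 : ℝ) else 0) := by
      refine le_trans ?_ (Finset.single_le_sum
        (f := fun k => if δ < z k then (1 : ℝ) else 0)
        (fun k _ => by split_ifs <;> norm_num) (Finset.mem_univ k))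
      simp [hk]
    nlinarith [mul_le_mul_of_nonneg_left this hε.le]
  · push Not at h3
    rw [h0 z hz h3, Finset.sum_eq_zero fun k _ => hsmall k (h3 k)]
    simpa using add_nonneg hfirst (mul_nonneg hε.le (hS3 z))

lemma integral_ite_one_zero {Ω : Type*} [MeasurableSpace Ω] {P : Measure Ω} {p : Ω → Prop}
    [DecidablePred p] (hp : MeasurableSet {ω | p ω}) :
    ∫ ω, (if p ω then (1 : ℝ) else 0) ∂P = P.real {ω | p ω} := by
  rw [← integral_indicator_one hp]
  simp only [Set.indicator_apply, Set.mem_ofPred_eq, Pi.one_apply]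

lemma integrable_ite_one_zero {Ω : Type*} [MeasurableSpace Ω] {P : Measure Ω} [IsFiniteMeasure P]
    {p : Ω → Prop} [DecidablePred p] (hp : MeasurableSet {ω | p ω}) :
    Integrable (fun ω => if p ω then (1 : ℝ) else 0) P := by
  refine ((integrable_const (1 : ℝ)).indicator hp).congr (ae_of_all _ fun ω => ?_)
  simp only [Set.indicator_apply, Set.mem_ofPred_eq]

section

variable {d : ℕ} {Ω : Type*} [MeasurableSpace Ω] {P : Measure Ω}
  {W : ℕ → Ω → Fin d → ℝ}

/-- For rows of independent coordinates with regularly varying tails, two different coordinates are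
asymptotically never large together. -/
lemma tendsto_mul_measureReal_pair_zero
    (hindep : ∀ n, iIndepFun (fun i ω => W n ω i) P) {z : ℝ} {c : Fin d → ℝ}
    (htail : ∀ i, Tendsto (fun n : ℕ => (n : ℝ) * P.real {ω | z < W n ω i}) atTop (𝓝 (c i)))
    {i j : Fin d} (hij : j ≠ i) :
    Tendsto (fun n : ℕ => (n : ℝ) * P.real {ω | z < W n ω i ∧ z < W n ω j}) atTop (𝓝 0) := by
  have hprod : ∀ n, P.real {ω | z < W n ω i ∧ z < W n ω j} =
      P.real {ω | z < W n ω i} * P.real {ω | z < W n ω j} := by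
    intro n
    have := ((hindep n).indepFun hij.symm).measure_inter_preimage_eq_mul (Set.Ioi z) (Set.Ioi z)
      measurableSet_Ioi measurableSet_Ioi
    simp only [Measure.real]
    rw [← ENNReal.toReal_mul]
    exact congrArg ENNReal.toReal this
  -- $n\,pq=(np)(nq)/n$.
  have hlim := ((htail i).mul (htail j)).mul tendsto_inv_atTop_nhds_zero_nat
  rw [mul_zero] at hlim
  refine hlim.congr' ?_
  filter_upwards [eventually_ne_atTop 0] with n hn
  rw [hprod]
  field_simp

/-- Single big jump principle, in expectation. -/
lemma tendsto_mul_integral_sub_sum_single [IsFiniteMeasure P]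
    (hW : ∀ n, Measurable (W n)) (hW0 : ∀ n ω, 0 ≤ W n ω)
    (hindep : ∀ n, iIndepFun (fun i ω => W n ω i) P)
    {c : ℝ → ℝ} (hc : Tendsto c atTop (𝓝 0))
    (htail : ∀ i, ∀ z > 0,
      Tendsto (fun n : ℕ => (n : ℝ) * P.real {ω | z < W n ω i}) atTop (𝓝 (c z)))
    {G : (Fin d → ℝ) → ℝ} (hGm : Measurable G)
    (hG : ContinuousOn G (Set.Ici 0)) {B δ : ℝ} (hB : ∀ z, |G z| ≤ B) (hδ : 0 < δ)
    (h0 : ∀ z, 0 ≤ z → (∀ i, z i ≤ δ) → G z = 0) :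
    Tendsto (fun n : ℕ => (n : ℝ) * ∫ ω, G (W n ω) ∂P -
      ∑ k, (n : ℝ) * ∫ ω, G (Pi.single k (W n ω k)) ∂P) atTop (𝓝 0) := by
  have hint : ∀ f : Ω → Fin d → ℝ, Measurable f → Integrable (fun ω => G (f ω)) P := fun f hf =>
    Integrable.of_bound (hGm.comp hf).aestronglyMeasurable B (ae_of_all _ fun ω => hB _)
  have hWk : ∀ n k, Measurable fun ω => W n ω k := fun n k => (measurable_pi_apply k).comp (hW n)
  have hsm : ∀ n k, Measurable fun ω => (Pi.single k (W n ω k) : Fin d → ℝ) := by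
    intro n k
    refine measurable_pi_lambda _ fun i => ?_
    rcases eq_or_ne i k with rfl | hik
    · simpa using hWk n i
    · simp [hik]
  have hms : ∀ n k (z : ℝ), MeasurableSet {ω | z < W n ω k} := fun n k z =>
    measurableSet_lt measurable_const (hWk n k)
  have hms2 : ∀ n k j (z : ℝ), MeasurableSet {ω | j ≠ k ∧ z < W n ω k ∧ z < W n ω j} :=
    fun n k j z => (MeasurableSet.const _).inter ((hms n k z).inter (hms n j z))
  rw [Metric.tendsto_atTop']
  intro ε hε
  -- `M` and `ε'` are fixed before `η`, which depends on both. This is harmless: the pair terms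
  -- vanish in the limit for every `η > 0`.
  obtain ⟨M, hM0, hM⟩ : ∃ M > 0, (d + 1) * B * d * c M < ε / 2 := by
    have h1 : Tendsto (fun M => (d + 1) * B * d * c M) atTop (𝓝 0) := by
      simpa using hc.const_mul ((d + 1) * B * d)
    obtain ⟨M, hM⟩ := ((h1.eventually_lt_const (half_pos hε)).and (eventually_gt_atTop 0)).exists
    exact ⟨M, hM.2, hM.1⟩
  obtain ⟨ε', hε', hε'2⟩ : ∃ ε' > 0, ε' * (d * c δ) < ε / 2 := by
    have h1 : Tendsto (fun x : ℝ => x * (d * c δ)) (𝓝[>] 0) (𝓝 0) := by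
      have : Tendsto (fun x : ℝ => x * (d * c δ)) (𝓝 0) (𝓝 (0 * (d * c δ))) :=
        tendsto_id.mul_const _
      rw [zero_mul] at this
      exact this.mono_left nhdsWithin_le_nhds
    obtain ⟨x, hx⟩ := ((h1.eventually_lt_const (half_pos hε)).and self_mem_nhdsWithin).exists
    exact ⟨x, hx.2, hx.1⟩
  obtain ⟨η, hη, hbound⟩ := exists_forall_abs_sub_sum_single_le hG hB hδ h0 M hε'
  let pair : ℕ → Fin d → Fin d → ℝ := fun n k j =>
    P.real {ω | j ≠ k ∧ η < W n ω k ∧ η < W n ω j}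
  have hpair : ∀ k j, Tendsto (fun n : ℕ => (n : ℝ) * pair n k j) atTop (𝓝 0) := by
    intro k j
    by_cases hjk : j = k
    · simp [pair, hjk]
    · simpa [pair, hjk] using
        tendsto_mul_measureReal_pair_zero hindep (fun i => htail i η hη) hjk
  have hlim : Tendsto (fun n : ℕ =>
      (d + 1) * B * (∑ k, (n : ℝ) * P.real {ω | M < W n ω k} +
        ∑ k, ∑ j, (n : ℝ) * pair n k j) +
      ε' * ∑ k, (n : ℝ) * P.real {ω | δ < W n ω k}) atTop
      (𝓝 ((d + 1) * B * (∑ _k : Fin d, c M + ∑ _k : Fin d, ∑ _j : Fin d, 0) +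
        ε' * ∑ _k : Fin d, c δ)) := by
    refine (((tendsto_finsetSum _ fun k _ => htail k M hM0).add
      (tendsto_finsetSum _ fun k _ => tendsto_finsetSum _ fun j _ => hpair k j)).const_mul _).add
      ((tendsto_finsetSum _ fun k _ => htail k δ hδ).const_mul _)
  have hlt : (d + 1) * B * (∑ _k : Fin d, c M + ∑ _k : Fin d, ∑ _j : Fin d, 0) +
        ε' * ∑ _k : Fin d, c δ < ε := by
    simp only [Finset.sum_const, Finset.card_univ, Fintype.card_fin, nsmul_eq_mul, smul_zero,
      add_zero]
    linarith
  obtain ⟨N, hN⟩ := eventually_atTop.mp (hlim.eventually_lt_const hlt)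
  refine ⟨N, fun n hn => lt_of_le_of_lt ?_ (hN n hn.le)⟩
  have hi1 : Integrable (fun ω => ∑ k, (if M < W n ω k then (1 : ℝ) else 0)) P :=
    integrable_finsetSum _ fun k _ => integrable_ite_one_zero (hms n k M)
  have hi2 : Integrable (fun ω => ∑ k, ∑ j,
      (if j ≠ k ∧ η < W n ω k ∧ η < W n ω j then (1 : ℝ) else 0)) P :=
    integrable_finsetSum _ fun k _ => integrable_finsetSum _ fun j _ =>
      integrable_ite_one_zero (hms2 n k j η)
  have hi3 : Integrable (fun ω => ∑ k, (if δ < W n ω k then (1 : ℝ) else 0)) P :=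
    integrable_finsetSum _ fun k _ => integrable_ite_one_zero (hms n k δ)
  have hi12 : Integrable (fun ω => ∑ k, (if M < W n ω k then (1 : ℝ) else 0) +
      ∑ k, ∑ j, (if j ≠ k ∧ η < W n ω k ∧ η < W n ω j then (1 : ℝ) else 0)) P := hi1.add hi2
  rw [Real.dist_eq, sub_zero, ← Finset.mul_sum, ← mul_sub,
    ← integral_finsetSum _ fun k _ => hint _ (hsm n k),
    ← integral_sub (hint _ (hW n)) (integrable_finsetSum _ fun k _ => hint _ (hsm n k)),
    abs_mul, Nat.abs_cast]
  calc (n : ℝ) * |∫ ω, (G (W n ω) - ∑ k, G (Pi.single k (W n ω k))) ∂P|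
      ≤ n * ∫ ω, ((d + 1) * B * (∑ k, (if M < W n ω k then (1 : ℝ) else 0) +
          ∑ k, ∑ j, (if j ≠ k ∧ η < W n ω k ∧ η < W n ω j then (1 : ℝ) else 0)) +
          ε' * ∑ k, (if δ < W n ω k then (1 : ℝ) else 0)) ∂P := by
        refine mul_le_mul_of_nonneg_left ?_ n.cast_nonneg
        refine (abs_integral_le_integral_abs).trans (integral_mono ?_ ?_ fun ω => hbound _ (hW0 n ω))
        · exact ((hint _ (hW n)).sub (integrable_finsetSum _ fun k _ => hint _ (hsm n k))).abs
        · exact (hi12.const_mul _).add (hi3.const_mul _)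
    _ = _ := by
        rw [integral_add (hi12.const_mul _) (hi3.const_mul _), integral_const_mul,
          integral_const_mul, integral_add hi1 hi2,
          integral_finsetSum _ fun k _ => integrable_ite_one_zero (hms n k M),
          integral_finsetSum _ fun k _ => integrable_ite_one_zero (hms n k δ),
          integral_finsetSum _ fun k _ => integrable_finsetSum _ fun j _ =>
            integrable_ite_one_zero (hms2 n k j η)]
        simp_rw [integral_finsetSum _ fun j _ => integrable_ite_one_zero (hms2 n _ j η),
          integral_ite_one_zero (hms2 n _ _ η), integral_ite_one_zero (hms n _ _), pair]
        simp_rw [← Finset.mul_sum]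
        ring

end

/-! ### Test functions in polar coordinates -/

/-- Pulling back and pushing forward restricts `μ` to the range, and the zero extension ignores the
rest. Integrals against `polarLaw` and `powerMeasure` are computed this way. -/
lemma MeasurableEmbedding.integral_comap_eq_integral_extend {α β : Type*} [MeasurableSpace α]
    [MeasurableSpace β] {e : α → β} (he : MeasurableEmbedding e) (μ : Measure β) (f : α → ℝ) :
    ∫ x, f x ∂(μ.comap e) = ∫ y, Function.extend e f 0 y ∂μ := by
  calc ∫ x, f x ∂(μ.comap e)
      = ∫ x, Function.extend e f 0 (e x) ∂(μ.comap e) := by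
        simp_rw [he.injective.extend_apply]
    _ = ∫ y, Function.extend e f 0 y ∂((μ.comap e).map e) := (he.integral_map _).symm
    _ = ∫ y in Set.range e, Function.extend e f 0 y ∂μ := by rw [he.map_comap]
    _ = _ := setIntegral_eq_integral_of_forall_compl_eq_zero fun y hy =>
        Function.extend_apply' _ _ _ hy

section polar

variable {d : ℕ}

lemma isClosed_posSphere (d : ℕ) : IsClosed (posSphere d) := by
  have : posSphere d = (⋂ i, {w : EuclideanSpace ℝ (Fin d) | 0 ≤ w i}) ∩ {w | ‖w‖ = 1} := by
    ext w
    simp [posSphere]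
  rw [this]
  exact (isClosed_iInter fun i => isClosed_le continuous_const (by fun_prop)).inter
    (isClosed_eq continuous_norm continuous_const)

instance (d : ℕ) : CompactSpace (posSphere d) :=
  isCompact_iff_compactSpace.mp <|
    (isCompact_sphere (0 : EuclideanSpace ℝ (Fin d)) 1).of_isClosed_subset (isClosed_posSphere d)
      fun w hw => by simpa using hw.2

lemma measurableEmbedding_polar (d : ℕ) : MeasurableEmbedding
    (Prod.map Subtype.val Subtype.val :
      PosRadii × posSphere d → ℝ≥0∞ × EuclideanSpace ℝ (Fin d)) :=
  (MeasurableEmbedding.subtype_coe measurableSet_Ioi).prodMap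
    (MeasurableEmbedding.subtype_coe (isClosed_posSphere d).measurableSet)

/-- The radius attains a positive minimum on `K`. Compact support thereby becomes vanishing near the
origin. -/
lemma exists_ofReal_lt_of_isCompact {K : Set PosRadii} (hK : IsCompact K) :
    ∃ ε : ℝ, 0 < ε ∧ ∀ r ∈ K, ENNReal.ofReal ε < r.1 := by
  rcases K.eq_empty_or_nonempty with rfl | hne
  · exact ⟨1, one_pos, fun r hr => absurd hr (Set.notMem_empty r)⟩
  obtain ⟨r₀, -, hmin⟩ := hK.exists_isMinOn hne continuous_subtype_val.continuousOn
  obtain ⟨ε, hε0, hε⟩ := ENNReal.lt_iff_exists_nnreal_btwn.mp r₀.2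
  refine ⟨ε, by simpa using hε0, fun r hr => ?_⟩
  rw [ENNReal.ofReal_coe_nnreal]
  exact hε.trans_le (hmin hr)

/-- The function on Euclidean space whose expression in polar coordinates is `f`, extended by zero
outside the punctured orthant. -/
noncomputable def polarLift (f : PosRadii × posSphere d → ℝ) (x : EuclideanSpace ℝ (Fin d)) : ℝ :=
  Function.extend (Prod.map Subtype.val Subtype.val) f 0 (ENNReal.ofReal ‖x‖, ‖x‖⁻¹ • x)

lemma inv_norm_smul_mem_posSphere {x : EuclideanSpace ℝ (Fin d)} (hx : ∀ i, 0 ≤ x i)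
    (hx0 : x ≠ 0) : ‖x‖⁻¹ • x ∈ posSphere d :=
  ⟨fun i => mul_nonneg (inv_nonneg.mpr (norm_nonneg x)) (hx i), norm_smul_inv_norm hx0⟩

lemma ofReal_norm_mem_posRadii {x : EuclideanSpace ℝ (Fin d)} (hx0 : x ≠ 0) :
    ENNReal.ofReal ‖x‖ ∈ Set.Ioi (0 : ℝ≥0∞) :=
  ENNReal.ofReal_pos.mpr (norm_pos_iff.mpr hx0)

lemma polarLift_apply (f : PosRadii × posSphere d → ℝ) {x : EuclideanSpace ℝ (Fin d)}
    (hx : ∀ i, 0 ≤ x i) (hx0 : x ≠ 0) :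
    polarLift f x =
      f (⟨ENNReal.ofReal ‖x‖, ofReal_norm_mem_posRadii hx0⟩,
        ⟨‖x‖⁻¹ • x, inv_norm_smul_mem_posSphere hx hx0⟩) :=
  (measurableEmbedding_polar d).injective.extend_apply f 0
    (⟨ENNReal.ofReal ‖x‖, ofReal_norm_mem_posRadii hx0⟩,
      ⟨‖x‖⁻¹ • x, inv_norm_smul_mem_posSphere hx hx0⟩)

/-- With no sign condition on `x`, this transfers bounds and vanishing from `f` to its lift on the
whole space. -/
lemma polarLift_eq_zero_or_exists (f : PosRadii × posSphere d → ℝ)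
    (x : EuclideanSpace ℝ (Fin d)) :
    polarLift f x = 0 ∨ ∃ p, p.1.1 = ENNReal.ofReal ‖x‖ ∧ polarLift f x = f p := by
  by_cases h : ∃ p : PosRadii × posSphere d,
      Prod.map Subtype.val Subtype.val p = (ENNReal.ofReal ‖x‖, ‖x‖⁻¹ • x)
  · obtain ⟨p, hp⟩ := h
    refine Or.inr ⟨p, congrArg Prod.fst hp, ?_⟩
    rw [polarLift, ← hp, (measurableEmbedding_polar d).injective.extend_apply]
  · exact Or.inl (Function.extend_apply' _ _ _ h)

lemma measurable_polarLift {f : PosRadii × posSphere d → ℝ} (hf : Measurable f) :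
    Measurable (polarLift f) :=
  ((measurableEmbedding_polar d).measurable_extend hf measurable_const).comp
    (Measurable.prodMk (by fun_prop) (by fun_prop))

lemma abs_polarLift_le {f : PosRadii × posSphere d → ℝ} {B : ℝ} (hB0 : 0 ≤ B)
    (hB : ∀ p, |f p| ≤ B) (x : EuclideanSpace ℝ (Fin d)) : |polarLift f x| ≤ B := by
  rcases polarLift_eq_zero_or_exists f x with h | ⟨p, -, h⟩ <;> rw [h]
  · simpa using hB0
  · exact hB p

lemma exists_polarLift_eq_zero {f : PosRadii × posSphere d → ℝ} (hf : HasCompactSupport f) :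
    ∃ ε > 0, ∀ x, ‖x‖ ≤ ε → polarLift f x = 0 := by
  obtain ⟨ε, hε, h⟩ := exists_ofReal_lt_of_isCompact (IsCompact.image hf continuous_fst)
  refine ⟨ε, hε, fun x hx => ?_⟩
  rcases polarLift_eq_zero_or_exists f x with h0 | ⟨p, hp, hfp⟩
  · exact h0
  rw [hfp]
  by_contra hne
  have := h p.1 ⟨p, subset_tsupport f hne, rfl⟩
  rw [hp] at this
  exact (ENNReal.ofReal_le_ofReal hx).not_gt this

/-- Polar coordinates are continuous off the origin, and near the origin the lift is zero. The
extension by zero may jump across the boundary of the orthant. -/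
lemma continuousOn_polarLift {f : PosRadii × posSphere d → ℝ} (hf : Continuous f)
    (hfc : HasCompactSupport f) :
    ContinuousOn (polarLift f) {x | ∀ i, 0 ≤ x i} := by
  have hU : ContinuousOn (polarLift f) ({x | ∀ i, 0 ≤ x i} ∩ {0}ᶜ) := by
    rw [continuousOn_iff_continuous_domRestrict]
    have : Set.domRestrict ({x | ∀ i, 0 ≤ x i} ∩ {0}ᶜ) (polarLift f) =
        fun x : ↥({x : EuclideanSpace ℝ (Fin d) | ∀ i, 0 ≤ x i} ∩ {0}ᶜ) =>
          f (⟨ENNReal.ofReal ‖x.1‖, ofReal_norm_mem_posRadii x.2.2⟩,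
            ⟨‖x.1‖⁻¹ • x.1, inv_norm_smul_mem_posSphere x.2.1 x.2.2⟩) :=
      funext fun x => polarLift_apply f x.2.1 x.2.2
    rw [this]
    refine hf.comp (Continuous.prodMk (Continuous.subtype_mk ?_ _) (Continuous.subtype_mk ?_ _))
    · exact ENNReal.continuous_ofReal.comp (continuous_norm.comp continuous_subtype_val)
    · exact ((continuous_norm.comp continuous_subtype_val).inv₀ fun x =>
        norm_ne_zero_iff.mpr x.2.2).smul continuous_subtype_val
  intro x hx
  by_cases hx0 : x = 0
  · subst hx0
    obtain ⟨ε, hε, h⟩ := exists_polarLift_eq_zero hfc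
    have h0 : polarLift f =ᶠ[𝓝 0] fun _ => 0 := by
      filter_upwards [Metric.ball_mem_nhds (0 : EuclideanSpace ℝ (Fin d)) hε] with y hy
      exact h y (by simpa using (mem_ball_zero_iff.mp hy).le)
    exact ((continuousAt_const (y := (0 : ℝ))).congr h0.symm).continuousWithinAt
  · have := hU x ⟨hx, hx0⟩
    rwa [continuousWithinAt_inter (isOpen_compl_singleton.mem_nhds hx0)] at this

/-- The angle is invariant under positive scaling, so dividing the radius by `b` amounts to scaling
the vector. -/
lemma integral_polarLaw {Ω : Type*} [MeasurableSpace Ω] (P : Measure Ω)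
    {X : Ω → EuclideanSpace ℝ (Fin d)} (hX : Measurable X) {b : ℝ} (hb : 0 < b)
    {f : PosRadii × posSphere d → ℝ} (hf : Measurable f) :
    ∫ p, f p ∂(polarLaw P X b) = ∫ ω, polarLift f (b⁻¹ • X ω) ∂P := by
  rw [polarLaw, (measurableEmbedding_polar d).integral_comap_eq_integral_extend, integral_map]
  · refine integral_congr_ae (ae_of_all _ fun ω => ?_)
    have h1 : ‖b⁻¹ • X ω‖ = ‖X ω‖ / b := by
      rw [norm_smul, Real.norm_of_nonneg (inv_nonneg.mpr hb.le), div_eq_inv_mul]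
    have h2 : (‖X ω‖ / b)⁻¹ • b⁻¹ • X ω = ‖X ω‖⁻¹ • X ω := by
      rw [smul_smul, inv_div, div_eq_mul_inv, mul_right_comm, mul_inv_cancel₀ hb.ne', one_mul]
    simp only [polarLift, h1, h2]
  · exact (Measurable.prodMk (by fun_prop) (by fun_prop)).aemeasurable
  · exact ((measurableEmbedding_polar d).measurable_extend hf
      measurable_const).aestronglyMeasurable

end polar

/-! ### The radial measure -/

section power

/-- The measure on the line with density `α x ^ (-α - 1)` on `(0, ∞)`. -/
noncomputable def powerDensity (α : ℝ) : Measure ℝ :=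
  (volume.restrict (Set.Ioi (0 : ℝ))).withDensity fun x => ENNReal.ofReal (α * x ^ (-α - 1))

lemma ae_powerDensity_pos (α : ℝ) : ∀ᵐ t ∂(powerDensity α), 0 < t :=
  (withDensity_absolutelyContinuous _ _).ae_le (ae_restrict_mem measurableSet_Ioi)

lemma integral_powerDensity {α : ℝ} (hα : 0 < α) (g : ℝ → ℝ) :
    ∫ t, g t ∂(powerDensity α) = ∫ t in Set.Ioi 0, α * t ^ (-α - 1) * g t := by
  rw [powerDensity, integral_withDensity_eq_integral_toReal_smul (by fun_prop)
    (ae_of_all _ fun _ => ENNReal.ofReal_lt_top)]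
  refine setIntegral_congr_fun measurableSet_Ioi fun t ht => ?_
  simp only [smul_eq_mul]
  rw [ENNReal.toReal_ofReal (mul_nonneg hα.le (Real.rpow_nonneg (le_of_lt ht) _))]

lemma powerDensity_Ioi {α : ℝ} (hα : 0 < α) {z : ℝ} (hz : 0 < z) :
    powerDensity α (Set.Ioi z) = ENNReal.ofReal (z ^ (-α)) := by
  have hlt : -α - 1 < -1 := by linarith
  have hint : IntegrableOn (fun x : ℝ => α * x ^ (-α - 1)) (Set.Ioi z) :=
    (integrableOn_Ioi_rpow_of_lt hlt hz).const_mul α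
  rw [powerDensity, withDensity_apply _ measurableSet_Ioi,
    Measure.restrict_restrict measurableSet_Ioi,
    Set.inter_eq_left.mpr (Set.Ioi_subset_Ioi hz.le),
    ← ofReal_integral_eq_lintegral_ofReal hint]
  · rw [integral_const_mul, integral_Ioi_rpow_of_lt hlt hz]
    congr 1
    rw [sub_add_cancel]
    field_simp
  · filter_upwards [ae_restrict_mem measurableSet_Ioi] with t ht
    exact mul_nonneg hα.le (Real.rpow_nonneg (hz.trans ht).le _)

/-- Homogeneity, by substituting $u=ct$. The factor $c^\alpha$ is the source of the masses
$\|a_k\|^2$. -/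
lemma integral_powerDensity_comp_mul_left {α : ℝ} (hα : 0 < α) {c : ℝ} (hc : 0 < c) (g : ℝ → ℝ) :
    ∫ t, g (c * t) ∂(powerDensity α) = c ^ α * ∫ t, g t ∂(powerDensity α) := by
  have h := integral_comp_mul_left_Ioi (fun u => α * (u / c) ^ (-α - 1) * g u) 0 hc
  rw [integral_powerDensity hα, integral_powerDensity hα, ← integral_const_mul]
  simp only [mul_div_cancel_left₀ _ hc.ne', mul_zero] at h
  rw [h, smul_eq_mul, ← integral_const_mul]
  refine setIntegral_congr_fun measurableSet_Ioi fun t ht => ?_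
  rw [Real.div_rpow (le_of_lt ht) hc.le, Real.rpow_sub hc, Real.rpow_neg hc.le, Real.rpow_one]
  have := (Real.rpow_pos_of_pos hc α).ne'
  field_simp

/-- There is no mass at $\infty$, so agreement at finite radii suffices. -/
lemma integral_powerMeasure {α : ℝ} {g : PosRadii → ℝ} (hg : Measurable g) {h : ℝ → ℝ}
    (hgh : ∀ t (ht : 0 < t), g ⟨ENNReal.ofReal t, ENNReal.ofReal_pos.mpr ht⟩ = h t) :
    ∫ r, g r ∂(powerMeasure α) = ∫ t, h t ∂(powerDensity α) := by
  have he : MeasurableEmbedding (Subtype.val : PosRadii → ℝ≥0∞) :=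
    MeasurableEmbedding.subtype_coe measurableSet_Ioi
  rw [powerMeasure, he.integral_comap_eq_integral_extend, integral_map]
  · refine integral_congr_ae ?_
    filter_upwards [ae_powerDensity_pos α] with t ht
    rw [← hgh t ht]
    exact he.injective.extend_apply g 0 ⟨ENNReal.ofReal t, ENNReal.ofReal_pos.mpr ht⟩
  · exact ENNReal.measurable_ofReal.aemeasurable
  · exact (he.measurable_extend hg measurable_const).aestronglyMeasurable

lemma isFiniteMeasureOnCompacts_powerMeasure {α : ℝ} (hα : 0 < α) :
    IsFiniteMeasureOnCompacts (powerMeasure α) := by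
  refine ⟨fun K hK => ?_⟩
  obtain ⟨ε, hε, h⟩ := exists_ofReal_lt_of_isCompact hK
  have he : MeasurableEmbedding (Subtype.val : PosRadii → ℝ≥0∞) :=
    MeasurableEmbedding.subtype_coe measurableSet_Ioi
  calc powerMeasure α K
      ≤ powerMeasure α (Subtype.val ⁻¹' Set.Ioi (ENNReal.ofReal ε)) := measure_mono h
    _ ≤ powerDensity α (Set.Ioi ε) := by
        rw [powerMeasure, he.comap_apply, Subtype.image_preimage_coe]
        refine (measure_mono Set.inter_subset_right).trans ?_
        rw [Measure.map_apply ENNReal.measurable_ofReal measurableSet_Ioi]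
        exact measure_mono fun t ht => (ENNReal.ofReal_lt_ofReal_iff_of_nonneg hε.le).mp ht
    _ < ∞ := by
        rw [powerDensity_Ioi hα hε]
        exact ENNReal.ofReal_lt_top

/-- Needed for Fubini on the product with an angular measure. -/
lemma sFinite_powerMeasure {α : ℝ} (hα : 0 < α) : SFinite (powerMeasure α) := by
  have := isFiniteMeasureOnCompacts_powerMeasure hα
  have : LocallyCompactSpace PosRadii :=
    (isOpen_Ioi (a := (0 : ℝ≥0∞))).locallyCompactSpace
  infer_instance

end power

/-! ### Uniqueness of the angular measure -/

/-- The cut-off `r ↦ min (r - 1) 1` on radii, which vanishes for `r ≤ 1`. -/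
noncomputable def radialCutoff (r : PosRadii) : ℝ := (min (r.1 - 1) 1).toReal

lemma continuous_radialCutoff : Continuous radialCutoff := by
  have h : Continuous fun r : PosRadii => min (r.1 - 1) 1 :=
    ((ENNReal.continuous_sub_right 1).comp continuous_subtype_val).min continuous_const
  exact ENNReal.continuousOn_toReal.comp_continuous h fun r =>
    ne_top_of_le_ne_top ENNReal.one_ne_top (min_le_right _ _)

/-- The point $\infty$ belongs to the space, so this is a closed part of the compact $[0,\infty]$.
-/
lemma isCompact_one_le_posRadii : IsCompact {r : PosRadii | 1 ≤ r.1} := by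
  rw [Topology.IsInducing.subtypeVal.isCompact_iff]
  have : Subtype.val '' {r : PosRadii | 1 ≤ r.1} = Set.Ici (1 : ℝ≥0∞) := by
    ext x
    simp only [Set.mem_image, Set.mem_ofPred_eq, Subtype.exists, Set.mem_Ici]
    exact ⟨by rintro ⟨a, _, h, rfl⟩; exact h, fun h => ⟨x, one_pos.trans_le h, h, rfl⟩⟩
  rw [this]
  exact isClosed_Ici.isCompact

lemma radialCutoff_eq_zero {r : PosRadii} (hr : ¬ 1 ≤ r.1) : radialCutoff r = 0 := by
  simp [radialCutoff, tsub_eq_zero_of_le (not_le.mp hr).le]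

lemma integral_radialCutoff_pos {α : ℝ} (hα : 0 < α) :
    0 < ∫ r, radialCutoff r ∂(powerMeasure α) := by
  have hfin := isFiniteMeasureOnCompacts_powerMeasure hα
  have hcs : HasCompactSupport radialCutoff :=
    HasCompactSupport.intro isCompact_one_le_posRadii fun r hr => radialCutoff_eq_zero hr
  rw [integral_pos_iff_support_of_nonneg
    (show 0 ≤ radialCutoff from fun r => ENNReal.toReal_nonneg)
    (continuous_radialCutoff.integrable_of_hasCompactSupport hcs)]
  have he : MeasurableEmbedding (Subtype.val : PosRadii → ℝ≥0∞) :=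
    MeasurableEmbedding.subtype_coe measurableSet_Ioi
  have hsub : (Subtype.val ⁻¹' Set.Ioi 1 : Set PosRadii) ⊆ Function.support radialCutoff := by
    intro r hr
    have h1 : 0 < min (r.1 - 1) 1 := lt_min (tsub_pos_of_lt hr) one_pos
    exact (ENNReal.toReal_pos h1.ne'
      (ne_top_of_le_ne_top ENNReal.one_ne_top (min_le_right _ _))).ne'
  refine lt_of_lt_of_le ?_ (measure_mono hsub)
  rw [powerMeasure, he.comap_apply, Subtype.image_preimage_coe,
    Set.inter_eq_right.mpr (Set.Ioi_subset_Ioi zero_le_one),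
    Measure.map_apply ENNReal.measurable_ofReal measurableSet_Ioi]
  have : ENNReal.ofReal ⁻¹' Set.Ioi 1 = Set.Ioi (1 : ℝ) := by
    ext t
    simp
  rw [this]
  change 0 < powerDensity α (Set.Ioi 1)
  rw [powerDensity_Ioi hα one_pos]
  simp

/-- The angular measure with a given index and normalising sequence is unique. -/
lemma IsAngularMeasure.unique {d : ℕ} {Ω : Type*} [MeasurableSpace Ω] {P : Measure Ω}
    {X : Ω → EuclideanSpace ℝ (Fin d)} {α : ℝ} (hα : 0 < α) {b : ℕ → ℝ}
    {H H' : Measure (posSphere d)} (hH : IsAngularMeasure P X α b H)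
    (hH' : IsAngularMeasure P X α b H') : H = H' := by
  have := hH.finite
  have := hH'.finite
  have := sFinite_powerMeasure hα
  refine ext_of_forall_integral_eq_of_IsFiniteMeasure fun h => ?_
  -- The sphere part is compact, so any continuous `h` may be multiplied by the radial cut-off; its
  -- positive radial integral then cancels.
  let f : CompactlySupportedContinuousMap (PosRadii × posSphere d) ℝ :=
    { toFun := fun p => radialCutoff p.1 * h p.2
      continuous_toFun := (continuous_radialCutoff.comp continuous_fst).mul
        (h.continuous.comp continuous_snd)
      hasCompactSupport' := HasCompactSupport.intro
        (isCompact_one_le_posRadii.prod isCompact_univ) fun p hp => by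
          rw [radialCutoff_eq_zero (fun h1 => hp ⟨h1, Set.mem_univ _⟩), zero_mul] }
  have heq := tendsto_nhds_unique (hH.vague f) (hH'.vague f)
  change ∫ p, radialCutoff p.1 * h p.2 ∂((powerMeasure α).prod H) =
    ∫ p, radialCutoff p.1 * h p.2 ∂((powerMeasure α).prod H') at heq
  rw [integral_prod_mul radialCutoff h, integral_prod_mul radialCutoff h] at heq
  exact mul_left_cancel₀ (integral_radialCutoff_pos hα).ne' heq

/-! ### The discrete measure of the columns -/

section columns

variable {d : ℕ}

/-- The normalised columns of a non-negative matrix without zero columns. -/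
noncomputable def columnAngle {A : Matrix (Fin d) (Fin d) ℝ} (hA : ∀ i j, 0 ≤ A i j)
    (hA0 : ∀ k, columnVec A k ≠ 0) (k : Fin d) : posSphere d :=
  ⟨‖columnVec A k‖⁻¹ • columnVec A k, inv_norm_smul_mem_posSphere (fun i => hA i k) (hA0 k)⟩

/-- The discrete measure with mass `‖a_k‖ ^ 2` at the direction of each column `a_k`. -/
noncomputable def columnMeasure {A : Matrix (Fin d) (Fin d) ℝ} (hA : ∀ i j, 0 ≤ A i j)
    (hA0 : ∀ k, columnVec A k ≠ 0) : Measure (posSphere d) :=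
  ∑ k, ENNReal.ofReal (‖columnVec A k‖ ^ 2) • Measure.dirac (columnAngle hA hA0 k)

variable {A : Matrix (Fin d) (Fin d) ℝ} (hA : ∀ i j, 0 ≤ A i j) (hA0 : ∀ k, columnVec A k ≠ 0)

lemma isFiniteMeasure_columnMeasure : IsFiniteMeasure (columnMeasure hA hA0) := by
  refine ⟨?_⟩
  simp only [columnMeasure, Measure.finsetSum_apply, Measure.smul_apply, smul_eq_mul,
    measure_univ, mul_one]
  exact ENNReal.sum_lt_top.mpr fun k _ => ENNReal.ofReal_lt_top

lemma ofReal_norm_columnVec_sq_pos (k : Fin d) (hA0 : ∀ k, columnVec A k ≠ 0) :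
    0 < ENNReal.ofReal (‖columnVec A k‖ ^ 2) :=
  ENNReal.ofReal_pos.mpr (pow_pos (norm_pos_iff.mpr (hA0 k)) 2)

lemma columnMeasure_pos {U : Set (posSphere d)} {k : Fin d} (hk : columnAngle hA hA0 k ∈ U) :
    0 < columnMeasure hA hA0 U := by
  rw [columnMeasure, Measure.finsetSum_apply]
  refine lt_of_lt_of_le (ofReal_norm_columnVec_sq_pos k hA0) ?_
  refine le_trans ?_ (Finset.single_le_sum
    (f := fun k => (ENNReal.ofReal (‖columnVec A k‖ ^ 2) •
      Measure.dirac (columnAngle hA hA0 k)) U) (fun _ _ => zero_le) (Finset.mem_univ k))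
  simp [Measure.dirac_apply_of_mem hk]

/-- The atoms form a finite, hence closed, set of full measure, and each has positive mass. -/
lemma support_columnMeasure : (columnMeasure hA hA0).support = Set.range (columnAngle hA hA0) := by
  refine Set.Subset.antisymm (Measure.support_subset_of_isClosed
    (Set.finite_range _).isClosed ?_) ?_
  · rw [mem_ae_iff, columnMeasure, Measure.finsetSum_apply]
    refine Finset.sum_eq_zero fun k _ => ?_
    rw [Measure.smul_apply, Measure.dirac_apply' _ (Set.finite_range _).isClosed.measurableSet.compl]
    simp
  · rintro _ ⟨k, rfl⟩
    rw [Measure.mem_support_iff_forall]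
    exact fun U hU => columnMeasure_pos hA hA0 (mem_of_mem_nhds hU)

lemma integral_columnMeasure (f : posSphere d → ℝ) :
    ∫ w, f w ∂(columnMeasure hA hA0) =
      ∑ k, ‖columnVec A k‖ ^ 2 * f (columnAngle hA hA0 k) := by
  rw [columnMeasure, integral_finsetSum_measure]
  · refine Finset.sum_congr rfl fun k _ => ?_
    rw [integral_smul_measure, integral_dirac, ENNReal.toReal_ofReal (by positivity), smul_eq_mul]
  · exact fun k _ => (integrable_dirac (by simp)).smul_measure ENNReal.ofReal_ne_top

/-- The mass $\|a_k\|^2$ cancels the two normalising factors $\|a_k\|^{-1}$. -/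
lemma extremalDependence_columnMeasure (i j : Fin d) :
    extremalDependence (columnMeasure hA hA0) i j = ∑ k, A i k * A j k := by
  rw [extremalDependence, integral_columnMeasure]
  refine Finset.sum_congr rfl fun k _ => ?_
  have : ‖columnVec A k‖ ≠ 0 := norm_ne_zero_iff.mpr (hA0 k)
  change ‖columnVec A k‖ ^ 2 * ((‖columnVec A k‖⁻¹ * A i k) * (‖columnVec A k‖⁻¹ * A j k)) = _
  field_simp

/-- The polar integral against the product of the power measure and the discrete measure of the
columns is the sum of the integrals along the rays through the columns. -/
lemma integral_prod_columnMeasure {f : PosRadii × posSphere d → ℝ} (hf : Continuous f)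
    (hfc : HasCompactSupport f) :
    ∫ p, f p ∂((powerMeasure 2).prod (columnMeasure hA hA0)) =
      ∑ k, ∫ t, polarLift f (t • columnVec A k) ∂(powerDensity 2) := by
  have := isFiniteMeasure_columnMeasure hA hA0
  have := sFinite_powerMeasure (α := 2) two_pos
  have := isFiniteMeasureOnCompacts_powerMeasure (α := 2) two_pos
  rw [integral_prod_symm _ (hf.integrable_of_hasCompactSupport hfc), integral_columnMeasure]
  refine Finset.sum_congr rfl fun k _ => ?_
  have hpos : 0 < ‖columnVec A k‖ := norm_pos_iff.mpr (hA0 k)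
  have h1 : ∫ r, f (r, columnAngle hA hA0 k) ∂(powerMeasure 2) =
      ∫ t, polarLift f (t • (columnAngle hA hA0 k).1) ∂(powerDensity 2) := by
    refine integral_powerMeasure (hf.comp (by fun_prop)).measurable fun t ht => ?_
    set w := columnAngle hA hA0 k
    have hn : ‖t • w.1‖ = t := by rw [norm_smul, w.2.2, mul_one, Real.norm_of_nonneg ht.le]
    have hw0 : t • w.1 ≠ 0 := norm_ne_zero_iff.mp (by rw [hn]; exact ht.ne')
    rw [polarLift_apply f (fun i => mul_nonneg ht.le (w.2.1 i)) hw0]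
    refine congrArg f (Prod.ext (Subtype.ext ?_) (Subtype.ext ?_))
    · simp only [hn]
    · simp only [hn]
      rw [smul_smul, inv_mul_cancel₀ ht.ne', one_smul]
  -- Passing from the unit direction to $a_k$ itself absorbs the mass $\|a_k\|^2$.
  have h2 := integral_powerDensity_comp_mul_left (α := 2) two_pos hpos
    fun t => polarLift f (t • (columnAngle hA hA0 k).1)
  rw [h1, ← Real.rpow_two, ← h2]
  refine integral_congr_ae (ae_of_all _ fun t => ?_)
  simp only [columnAngle, smul_smul]
  rw [mul_right_comm, mul_inv_cancel₀ hpos.ne', one_mul]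

end columns

/-! ### Convergence for linear images -/

section linear

variable {d : ℕ} {Ω : Type*} [MeasurableSpace Ω] {P : Measure Ω}

lemma tendsto_mul_measureReal_of_isStandardised {Y : Ω → ℝ} (h : IsStandardised P Y 2)
    {z : ℝ} (hz : 0 < z) :
    Tendsto (fun n : ℕ => (n : ℝ) * P.real {ω | z < (√(n : ℝ))⁻¹ * Y ω}) atTop
      (𝓝 (z ^ (-2 : ℝ))) := by
  refine (h z hz).congr fun n => ?_
  rw [neg_div, Real.rpow_neg n.cast_nonneg, Real.sqrt_eq_rpow]

lemma toLp_mulVec_single (A : Matrix (Fin d) (Fin d) ℝ) (k : Fin d) (t : ℝ) :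
    WithLp.toLp 2 (A.mulVec (Pi.single k t)) = t • columnVec A k := by
  ext i
  simp [columnVec, mul_comm]

lemma continuous_toLp_mulVec (A : Matrix (Fin d) (Fin d) ℝ) :
    Continuous fun z : Fin d → ℝ => (WithLp.toLp 2 (A.mulVec z) : EuclideanSpace ℝ (Fin d)) :=
  (PiLp.continuous_toLp 2 _).comp (Continuous.matrix_mulVec continuous_const continuous_id)

lemma mulVec_nonneg {A : Matrix (Fin d) (Fin d) ℝ} (hA : ∀ i j, 0 ≤ A i j) {z : Fin d → ℝ}
    (hz : 0 ≤ z) (i : Fin d) : 0 ≤ A.mulVec z i :=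
  dotProduct_nonneg_of_nonneg (hA i) hz

/-- A non-negative linear image of independent standardised innovations has the discrete measure of
the columns as its angular measure. -/
theorem isAngularMeasure_columnMeasure [IsProbabilityMeasure P]
    {Z : Ω → EuclideanSpace ℝ (Fin d)} (hZ : Measurable Z) (hZ0 : ∀ ω i, 0 ≤ Z ω i) (hindep : iIndepFun (fun (i : Fin d) (ω : Ω) => Z ω i) P)
    (hstd : ∀ i, IsStandardised P (fun ω => Z ω i) 2)
    {A : Matrix (Fin d) (Fin d) ℝ} (hA : ∀ i j, 0 ≤ A i j) (hA0 : ∀ k, columnVec A k ≠ 0) :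
    IsAngularMeasure P (fun ω => WithLp.toLp 2 (A.mulVec (Z ω).ofLp)) 2
      (fun n => √(n : ℝ)) (columnMeasure hA hA0) := by
  refine ⟨isFiniteMeasure_columnMeasure hA hA0,
    Real.tendsto_sqrt_atTop.comp tendsto_natCast_atTop_atTop, fun f => ?_⟩
  have hf : Continuous f := f.continuous
  have hfc : HasCompactSupport f := f.hasCompactSupport
  obtain ⟨B, hB0, hB⟩ : ∃ B, 0 ≤ B ∧ ∀ p, |f p| ≤ B := by
    obtain ⟨C, hC⟩ := hfc.exists_bound_of_continuous hf
    exact ⟨max C 0, le_max_right _ _, fun p => (hC p).trans (le_max_left _ _)⟩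
  obtain ⟨ε, hε, hfε⟩ := exists_polarLift_eq_zero hfc
  let T : (Fin d → ℝ) → EuclideanSpace ℝ (Fin d) := fun z => WithLp.toLp 2 (A.mulVec z)
  have hT : Continuous T := continuous_toLp_mulVec A
  let G : (Fin d → ℝ) → ℝ := fun z => polarLift f (T z)
  have hGm : Measurable G := (measurable_polarLift hf.measurable).comp hT.measurable
  have hGc : ContinuousOn G (Set.Ici 0) :=
    (continuousOn_polarLift hf hfc).comp hT.continuousOn fun z hz => mulVec_nonneg hA hz
  have hGB : ∀ z, |G z| ≤ B := fun z => abs_polarLift_le hB0 hB _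
  obtain ⟨δ, hδ, hGδ⟩ : ∃ δ > 0, ∀ z, ‖z‖ ≤ δ → G z = 0 := by
    have hT0 : T 0 = 0 := by simp [T]
    obtain ⟨δ, hδ, h⟩ := Metric.continuous_iff.mp hT 0 ε hε
    refine ⟨δ / 2, half_pos hδ, fun z hz => hfε _ ?_⟩
    have := h z (by rw [dist_zero_right]; linarith)
    rw [hT0, dist_zero_right] at this
    exact this.le
  let W : ℕ → Ω → Fin d → ℝ := fun n ω i => (√(n : ℝ))⁻¹ * Z ω i
  have hZi : ∀ i, Measurable fun ω => Z ω i := fun i => by fun_prop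
  have hWi : ∀ n i, Measurable fun ω => W n ω i := fun n i => (hZi i).const_mul _
  have hW : ∀ n, Measurable (W n) := fun n => measurable_pi_lambda _ (hWi n)
  have hW0 : ∀ n ω, 0 ≤ W n ω := fun n ω i =>
    mul_nonneg (inv_nonneg.mpr (Real.sqrt_nonneg _)) (hZ0 ω i)
  have hWindep : ∀ n, iIndepFun (fun i ω => W n ω i) P := fun n =>
    hindep.comp (fun _ x => (√(n : ℝ))⁻¹ * x) fun _ => measurable_const_mul _
  have htail : ∀ i, ∀ z > 0, Tendsto (fun n : ℕ => (n : ℝ) * P.real {ω | z < W n ω i}) atTop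
      (𝓝 (z ^ (-2 : ℝ))) := fun i z hz => tendsto_mul_measureReal_of_isStandardised (hstd i) hz
  have hbig := tendsto_mul_integral_sub_sum_single hW hW0 hWindep
    (tendsto_rpow_neg_atTop two_pos) htail hGm hGc hGB hδ fun z hz hzδ => hGδ z <|
      (pi_norm_le_iff_of_nonneg hδ.le).mpr fun i => by
        rw [Real.norm_of_nonneg (hz i)]
        exact hzδ i
  have haxis : ∀ k, Tendsto (fun n : ℕ => (n : ℝ) * ∫ ω, G (Pi.single k (W n ω k)) ∂P) atTop
      (𝓝 (∫ t, polarLift f (t • columnVec A k) ∂(powerDensity 2))) := by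
    intro k
    -- `G` is continuous only on the orthant, so `t` is cut at zero. Neither side notices: `W` is
    -- non-negative and `powerDensity 2` lives on `t > 0`.
    have hsc : Continuous fun t : ℝ => (Pi.single k (max t 0) : Fin d → ℝ) :=
      (continuous_single (A := fun _ : Fin d => ℝ) k).comp (continuous_id.max continuous_const)
    let g : BoundedContinuousFunction ℝ ℝ := BoundedContinuousFunction.ofNormedAddCommGroup
      (fun t => G (Pi.single k (max t 0)))
      (hGc.comp_continuous hsc fun t => Pi.single_nonneg.mpr (le_max_right _ _)) B fun t => hGB _
    have hgδ : ∀ t ≤ δ, g t = 0 := fun t ht => hGδ _ <| by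
      rw [Pi.norm_single, Real.norm_of_nonneg (le_max_right _ _)]
      exact max_le ht hδ.le
    have hfin : ∀ n : ℕ, IsFiniteMeasure ((n : ℝ≥0∞) • P.map fun ω => W n ω k) := fun n =>
      (P.map fun ω => W n ω k).smul_finite (ENNReal.natCast_ne_top n)
    have hlim := tendsto_integral_of_tendsto_tail
      (μ := fun n : ℕ => (n : ℝ≥0∞) • P.map fun ω => W n ω k) (ν := powerDensity 2) (δ := δ)
      (by rw [powerDensity_Ioi two_pos hδ]; exact ENNReal.ofReal_ne_top)
      (by
        rw [powerDensity_Ioi two_pos hδ]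
        exact (ENNReal.ofReal_pos.mpr (Real.rpow_pos_of_pos hδ _)).ne')
      (fun z hz => by
        have hz0 := hδ.trans_le hz
        have e : (powerDensity 2).real (Set.Ioi z) = z ^ (-2 : ℝ) := by
          rw [Measure.real, powerDensity_Ioi two_pos hz0,
            ENNReal.toReal_ofReal (Real.rpow_nonneg hz0.le _)]
        rw [e]
        refine (htail k z hz0).congr fun n => ?_
        rw [measureReal_ennreal_smul_apply, map_measureReal_apply (hWi n k) measurableSet_Ioi,
          ENNReal.toReal_natCast]
        rfl)
      g hgδ
    have e2 : ∫ t, g t ∂(powerDensity 2) =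
        ∫ t, polarLift f (t • columnVec A k) ∂(powerDensity 2) := by
      refine integral_congr_ae ?_
      filter_upwards [ae_powerDensity_pos 2] with t ht
      rw [← toLp_mulVec_single]
      change G (Pi.single k (max t 0)) = _
      rw [max_eq_left ht.le]
    rw [← e2]
    refine hlim.congr fun n => ?_
    rw [integral_smul_measure, integral_map (hWi n k).aemeasurable
      g.continuous.aestronglyMeasurable, ENNReal.toReal_natCast, smul_eq_mul]
    congr 1
    refine integral_congr_ae (ae_of_all _ fun ω => ?_)
    change G (Pi.single k (max (W n ω k) 0)) = _
    rw [max_eq_left (show (0 : ℝ) ≤ W n ω k from hW0 n ω k)]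
  have hsum := hbig.add (tendsto_finsetSum Finset.univ fun k _ => haxis k)
  rw [zero_add] at hsum
  rw [integral_prod_columnMeasure hA hA0 hf hfc]
  refine hsum.congr' ?_
  -- At `n = 0` the normalisation $\sqrt n$ would vanish.
  filter_upwards [eventually_gt_atTop 0] with n hn
  have hb : 0 < √(n : ℝ) := Real.sqrt_pos.mpr (Nat.cast_pos.mpr hn)
  have hTZ : Measurable fun ω => T (Z ω).ofLp :=
    hT.measurable.comp (measurable_pi_lambda _ hZi)
  rw [integral_smul_measure, integral_polarLaw P hTZ hb hf.measurable, ENNReal.toReal_natCast,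
    smul_eq_mul, sub_add_cancel]
  congr 1
  refine integral_congr_ae (ae_of_all _ fun ω => ?_)
  change polarLift f (T ((√(n : ℝ))⁻¹ • (Z ω).ofLp)) = _
  simp only [T, Matrix.mulVec_smul, WithLp.toLp_smul]

end linear

/-! ### The main theorem -/

theorem mainTheorem5 {d : ℕ} {Ω : Type*} [MeasurableSpace Ω] (P : Measure Ω)
    [IsProbabilityMeasure P] (M : LSEMPlus d)
    (Z X : Ω → EuclideanSpace ℝ (Fin d))
    (hZ_meas : Measurable Z)
    (hZ_rv : IsRegularlyVarying P Z 2)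
    (hZ_indep : iIndepFun (fun (i : Fin d) (ω : Ω) => Z ω i) P)
    (hZ_std : ∀ i, IsStandardised P (fun ω => Z ω i) 2)
    (hX : M.IsSolution Z X) :
    -- the representation `X = A Z` with `A` non-negative
    (∀ ω, X ω = WithLp.toLp 2 (M.coeffMatrix.mulVec (Z ω).ofLp)) ∧
    (∀ i j, 0 ≤ M.coeffMatrix i j) ∧
    -- `X` is regularly varying, and its angular measure for `b n = n ^ (1 / 2)` is well defined
    IsRegularlyVarying P X 2 ∧
    (∃! H : Measure (posSphere d), IsAngularMeasure P X 2 (fun n => √(n : ℝ)) H) ∧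
    ∀ H : Measure (posSphere d), IsAngularMeasure P X 2 (fun n => √(n : ℝ)) H →
      -- (i) the support of the angular measure
      (Subtype.val '' H.support =
        Set.range fun k => ‖columnVec M.coeffMatrix k‖⁻¹ • columnVec M.coeffMatrix k) ∧
      -- (ii) the extremal dependence measure
      (∀ i j, extremalDependence H i j = (M.coeffMatrix * M.coeffMatrix.transpose) i j ∧
        extremalDependence H i j = ∑ k, M.coeffMatrix i k * M.coeffMatrix j k) ∧
      -- (iii) the squared scalings
      (∀ i, scaling H i ^ 2 = ∑ k, M.coeffMatrix i k ^ 2) := by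
  have hA := M.coeffMatrix_nonneg
  have hA0 := M.columnVec_coeffMatrix_ne_zero
  have hXA := hX.eq_coeffMatrix_mulVec
  have hang : IsAngularMeasure P X 2 (fun n => √(n : ℝ)) (columnMeasure hA hA0) := by
    rw [funext hXA]
    exact isAngularMeasure_columnMeasure hZ_meas hZ_rv.2.1 hZ_indep hZ_std hA hA0
  have hne : columnMeasure hA hA0 ≠ 0 := by
    -- For `d = 0` the sphere is empty and every measure on it is zero; the non-zero angular measure
    -- of `Z` excludes this.
    obtain ⟨-, -, -, H, hH, -⟩ := hZ_rv
    have : Nonempty (Fin d) := by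
      by_contra hd
      rw [not_nonempty_iff] at hd
      have : IsEmpty (posSphere d) := ⟨fun w => one_ne_zero <| by
        rw [← w.2.2, Subsingleton.elim w.1 0, norm_zero]⟩
      exact hH (Measure.eq_zero_of_isEmpty H)
    obtain ⟨k⟩ := this
    intro h0
    have := columnMeasure_pos hA hA0 (Set.mem_univ (columnAngle hA hA0 k))
    simp [h0] at this
  refine ⟨hXA, hA, ⟨two_pos, fun ω i => ?_, _, _, hne, hang⟩,
    ⟨_, hang, fun H hH => hH.unique two_pos hang⟩, fun H hH => ?_⟩
  · rw [hXA ω]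
    exact mulVec_nonneg hA (hZ_rv.2.1 ω) i
  obtain rfl : H = columnMeasure hA hA0 := hH.unique two_pos hang
  have hmom := extremalDependence_columnMeasure hA hA0
  refine ⟨?_, fun i j => ⟨?_, hmom i j⟩, fun i => ?_⟩
  · rw [support_columnMeasure, ← Set.range_comp]
    rfl
  · rw [hmom, Matrix.mul_apply]
    rfl
  · rw [scaling, hmom, Real.sq_sqrt (Finset.sum_nonneg fun k _ => mul_self_nonneg _)]
    exact Finset.sum_congr rfl fun k _ => (sq _).symm
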